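/- Let $E$ be a complex Hilbert space, $\mathbb D=\{z\in\mathbb C:|z|<1\}$, and let $\|\cdot\|$ be the operator norm on $B(E)$. Write $\partial=\frac12\left(\frac{\partial}{\partial x}-i\frac{\partial}{\partial y}\right)$ and $\Delta=\frac14\left(\frac{\partial^2}{\partial x^2}+\frac{\partial^2}{\partial y^2}\right)$. Let $\Pi:\mathbb D\to B(E)$ be a function whose values are orthogonal projections, and suppose that there exists a bounded analytic projection onto $\operatorname{Ran}\Pi(z)$, i.e. a bounded analytic function $\mathcal P:\mathbb D\to B(E)$ with $\mathcal P(z)^2=\mathcal P(z)$ and $\operatorname{Ran}\mathcal P(z)=\operatorname{Ran}\Pi(z)$ for all $z\in\mathbb D$. Assume also that for each $z\in\mathbb D$ either $\dim\operatorname{Ran}\Pi(z)<\infty$ or $\operatorname{codim}\operatorname{Ran}\Pi(z)<\infty$. Then $\Pi$ is of class $C^2$ on $\mathbb D$ in the operator norm, $\Pi\,\partial\Pi=0$ on $\mathbb D$, and: 1. there is a constant $C$ such that $\|\partial\Pi(z)\|\le \dfrac{C}{1-|z|}$ for all $z\in\mathbb D$; 2. the measure $d\nu=\|\partial\Pi(z)\|^2(1-|z|)\,dx\,dy$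 on $\mathbb D$ is a Carleson measure, i.e. there is a constant $C$ such that $\nu(\{z\in\mathbb D:|z-\xi|<r\})\le Cr$ for all $\xi$ with $|\xi|=1$ and all $r>0$; 3. there exists a bounded non-negative subharmonic function $\varphi$ on $\mathbb D$, of class $C^2$, such that $\Delta\varphi(z)\ge\|\partial\Pi(z)\|^2$ for all $z\in\mathbb D$. In particular, in the case of finite dimension or finite codimension, the condition that $\Pi$ is $C^2$ with $\Pi\,\partial\Pi=0$ and that a function $\varphi$ as in 3 exists is necessary for the existence of a bounded analytic projection onto $\operatorname{Ran}\Pi(z)$. -/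

import Mathlib

open MeasureTheory Metric
open scoped NNReal ENNReal ContDiff InnerProductSpace

/-- The open unit disk. -/
def unitDisk : Set ℂ := ball 0 1

/-- The operator `∂ = (1/2) (∂/∂x - i ∂/∂y)`, for functions that are real differentiable. -/
noncomputable def dz {F : Type*} [NormedAddCommGroup F] [NormedSpace ℂ F]
    (f : ℂ → F) (z : ℂ) : F :=
  (1 / 2 : ℂ) • (fderiv ℝ f z 1 - Complex.I • fderiv ℝ f z Complex.I)

/-- The normalized Laplacian `(1/4) (∂²/∂x² + ∂²/∂y²)`, for functions of class `C²`. -/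
noncomputable def normalizedLaplacian (φ : ℂ → ℝ) (z : ℂ) : ℝ :=
  (1 / 4 : ℝ) * Laplacian.laplacian φ z

/-- A (finite-valued) subharmonic function on a set `U`: it is upper semicontinuous and satisfies
the sub-mean value inequality on every closed disk inside `U`. -/
structure IsSubharmonicOn (φ : ℂ → ℝ) (U : Set ℂ) : Prop where
  upperSemicontinuousOn : UpperSemicontinuousOn φ U
  circleIntegrable : ∀ z r, 0 < r → closedBall z r ⊆ U → CircleIntegrable φ z r
  le_circleAverage : ∀ z r, 0 < r → closedBall z r ⊆ U → φ z ≤ Real.circleAverage φ z r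

/-- A Carleson measure on the unit disk: a measure carried by the disk that gives mass at most a
constant times `r` to the part of the disk within distance `r` of any point of the unit circle. -/
def IsCarlesonMeasure (ν : Measure ℂ) : Prop :=
  ν unitDiskᶜ = 0 ∧
    ∃ C : ℝ≥0, ∀ ξ : ℂ, ‖ξ‖ = 1 → ∀ r : ℝ, 0 < r →
      ν (ball ξ r ∩ unitDisk) ≤ ENNReal.ofReal (C * r)

section Projections

variable {E : Type*} [NormedAddCommGroup E] [InnerProductSpace ℂ E]

/-- The range of a bounded operator, as a subspace. -/
abbrev ran (A : E →L[ℂ] E) : Submodule ℂ E := LinearMap.range (A : E →ₗ[ℂ] E)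

/-- `P` is a bounded analytic function on the disk, and `P z` is a (not necessarily orthogonal)
projection onto the range of `Q z` for every `z` in the disk. -/
structure IsBoundedAnalyticProjectionOnto (P Q : ℂ → E →L[ℂ] E) : Prop where
  analytic : DifferentiableOn ℂ P unitDisk
  bounded : ∃ M : ℝ, ∀ z ∈ unitDisk, ‖P z‖ ≤ M
  idempotent : ∀ z ∈ unitDisk, P z * P z = P z
  range_eq : ∀ z ∈ unitDisk, ran (P z) = ran (Q z)

/-- The growth condition `‖∂Q(z)‖ ≤ C / (1 - |z|)`. -/
def DzGrowth (Q : ℂ → E →L[ℂ] E) : Prop :=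
  ∃ C : ℝ, ∀ z ∈ unitDisk, ‖dz Q z‖ ≤ C / (1 - ‖z‖)

/-- The measure `‖∂Q(z)‖² (1 - |z|) dx dy` on the disk. -/
noncomputable def dzMeasure (Q : ℂ → E →L[ℂ] E) : Measure ℂ :=
  (volume.restrict unitDisk).withDensity
    (fun z => ENNReal.ofReal (‖dz Q z‖ ^ 2 * (1 - ‖z‖)))

/-- There is a bounded non-negative subharmonic function `φ` of class `C²` on the disk with
`Δφ ≥ ‖∂Q‖²` for the normalized Laplacian. -/
def HasBoundedSubharmonicMajorant (Q : ℂ → E →L[ℂ] E) : Prop :=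
  ∃ φ : ℂ → ℝ,
    ContDiffOn ℝ 2 φ unitDisk ∧
    IsSubharmonicOn φ unitDisk ∧
    (∃ K : ℝ, ∀ z ∈ unitDisk, 0 ≤ φ z ∧ φ z ≤ K) ∧
    ∀ z ∈ unitDisk, ‖dz Q z‖ ^ 2 ≤ normalizedLaplacian φ z

end Projections

/-!
If `P` is an idempotent and `Q` is the orthogonal projection with the same range, then
`Q = P (P + P* - 1)⁻¹`, the inverse existing because `(P + P* - 1)² ≥ 1`
(`isUnit_add_star_sub_one`). Hence `Q` is as smooth as `P`. Differentiating `Q P = P`, `P Q = Q` and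
`Q* = Q` gives `Q ∂Q = 0` and `∂Q = (1 - Q) P' Q`
(`IsBoundedAnalyticProjectionOnto.dz_identities`), so that `‖∂Q‖ ≤ ‖P'‖`, and Cauchy's estimate for
`P'` is the growth condition.

The rank of a continuous family of idempotents on the disk is constant
(`rank_ran_eq_of_continuousOn`), so one of `P` and `1 - P`, say `R`, has constant finite rank `n`,
and its Hilbert–Schmidt norm is at most `√n ‖R‖`. Thus `R` is a bounded holomorphic function `f`
with values in the Hilbert space of Hilbert–Schmidt operators (`exists_differentiableOn_lp`), and
`‖∂Q‖ ≤ ‖P'‖ = ‖R'‖ ≤ ‖f'‖`. The rest holds for every bounded holomorphic Hilbert space valued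
function `f`: the function `φ = ‖f‖²` is subharmonic with `∂∂̄φ = ‖f'‖²`
(`normalizedLaplacian_norm_sq`), and `‖f'‖² (1 - |z|) dx dy` is a Carleson measure
(`lintegral_ball_norm_sq_deriv_le`). The latter is the Littlewood–Paley inequality
(`lintegral_norm_sq_deriv_le`), which follows from Parseval's identity on circles, applied to
the products of `f` with Szegő kernels.
-/

/-! ### Squared norms of holomorphic functions -/

lemma isOpen_unitDisk : IsOpen unitDisk := isOpen_ball

lemma unitDisk_mem_nhds {z : ℂ} (hz : z ∈ unitDisk) : unitDisk ∈ nhds z :=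
  isOpen_unitDisk.mem_nhds hz

lemma mem_unitDisk {z : ℂ} : z ∈ unitDisk ↔ ‖z‖ < 1 := by
  simp [unitDisk]

lemma DifferentiableOn.contDiffOn_real_unitDisk {F : Type*} [NormedAddCommGroup F]
    [NormedSpace ℂ F] [CompleteSpace F] {f : ℂ → F}
    (hf : DifferentiableOn ℂ f unitDisk) (n : ℕ∞ω) : ContDiffOn ℝ n f unitDisk :=
  (hf.contDiffOn isOpen_unitDisk).restrict_scalars ℝ

section SquaredNorm

variable {H : Type*} [NormedAddCommGroup H] [InnerProductSpace ℂ H]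

lemma fderiv_norm_sq_comp_apply {f : ℂ → H} (hf : DifferentiableOn ℂ f unitDisk) {z : ℂ}
    (hz : z ∈ unitDisk) (v : ℂ) :
    fderiv ℝ (fun z => ‖f z‖ ^ 2) z v = 2 * (⟪f z, v • deriv f z⟫_ℂ).re := by
  let _ : InnerProductSpace ℝ H := InnerProductSpace.complexToReal
  have hd : HasDerivAt f (deriv f z) z :=
    (hf.differentiableAt (unitDisk_mem_nhds hz)).hasDerivAt
  have h1 := (hd.hasFDerivAt.restrictScalars ℝ).norm_sq
  rw [h1.fderiv]
  simp [real_inner_eq_re_inner ℂ, inner_smul_right]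

variable [CompleteSpace H]

lemma contDiffOn_norm_sq {f : ℂ → H} (hf : DifferentiableOn ℂ f unitDisk) :
    ContDiffOn ℝ 2 (fun z => ‖f z‖ ^ 2) unitDisk := by
  let _ : InnerProductSpace ℝ H := InnerProductSpace.complexToReal
  exact (hf.contDiffOn_real_unitDisk 2).norm_sq ℝ

lemma fderiv_fderiv_norm_sq_apply {f : ℂ → H} (hf : DifferentiableOn ℂ f unitDisk) {z : ℂ}
    (hz : z ∈ unitDisk) (v : ℂ) :
    fderiv ℝ (fderiv ℝ (fun z => ‖f z‖ ^ 2)) z v v =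
      2 * (‖v • deriv f z‖ ^ 2 + (⟪f z, v ^ 2 • deriv (deriv f) z⟫_ℂ).re) := by
  have hd : HasDerivAt f (deriv f z) z :=
    (hf.differentiableAt (unitDisk_mem_nhds hz)).hasDerivAt
  have hd2 : HasDerivAt (deriv f) (deriv (deriv f) z) z :=
    ((hf.deriv isOpen_unitDisk).differentiableAt (unitDisk_mem_nhds hz)).hasDerivAt
  have hC : ContDiffAt ℝ 2 (fun z => ‖f z‖ ^ 2) z :=
    (contDiffOn_norm_sq hf).contDiffAt (unitDisk_mem_nhds hz)
  have hD : DifferentiableAt ℝ (fderiv ℝ (fun z => ‖f z‖ ^ 2)) z :=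
    (hC.fderiv_right (m := 1) (by norm_num)).differentiableAt (by norm_num)
  have h1 : fderiv ℝ (fderiv ℝ (fun z => ‖f z‖ ^ 2)) z v v =
      fderiv ℝ (fun w => fderiv ℝ (fun z => ‖f z‖ ^ 2) w v) z v := by
    rw [fderiv_clm_apply hD (differentiableAt_const v)]
    simp
  have h2 : (fun w => fderiv ℝ (fun z => ‖f z‖ ^ 2) w v) =ᶠ[nhds z]
      fun w => 2 * (⟪f w, v • deriv f w⟫_ℂ).re := by
    filter_upwards [unitDisk_mem_nhds hz] with w hw using fderiv_norm_sq_comp_apply hf hw v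
  rw [h1, h2.fderiv_eq]
  have h3 := (hd.hasFDerivAt.restrictScalars ℝ).inner ℂ
    ((hd2.hasFDerivAt.restrictScalars ℝ).const_smul v)
  have h4 := (Complex.reCLM.hasFDerivAt.comp z h3).const_mul 2
  have h5 : fderiv ℝ (fun w => 2 * (⟪f w, v • deriv f w⟫_ℂ).re) z = _ := h4.fderiv
  rw [h5]
  simp only [Pi.smul_apply, _root_.smul_apply, ContinuousLinearMap.comp_apply,
    Complex.reCLM_apply, smul_eq_mul, ContinuousLinearMap.prod_apply,
    ContinuousLinearMap.coe_restrictScalars', fderivInnerCLM_apply,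
    ContinuousLinearMap.toSpanSingleton_apply, Complex.add_re, smul_smul, pow_two]
  rw [← inner_self_eq_norm_mul_norm (𝕜 := ℂ) (v • deriv f z), add_comm]
  rfl

/-- For a holomorphic Hilbert space valued function, `∂∂̄ ‖f‖² = ‖f'‖²`. -/
lemma normalizedLaplacian_norm_sq {f : ℂ → H} (hf : DifferentiableOn ℂ f unitDisk) {z : ℂ}
    (hz : z ∈ unitDisk) :
    normalizedLaplacian (fun z => ‖f z‖ ^ 2) z = ‖deriv f z‖ ^ 2 := by
  rw [normalizedLaplacian, InnerProductSpace.laplacian_eq_iteratedFDeriv_complexPlane]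
  simp only [iteratedFDeriv_two_apply, Matrix.cons_val_zero, Matrix.cons_val_one]
  rw [fderiv_fderiv_norm_sq_apply hf hz, fderiv_fderiv_norm_sq_apply hf hz]
  simp [norm_smul]
  ring

lemma isSubharmonicOn_norm_sq {f : ℂ → H} (hf : DifferentiableOn ℂ f unitDisk) :
    IsSubharmonicOn (fun z => ‖f z‖ ^ 2) unitDisk where
  upperSemicontinuousOn := (contDiffOn_norm_sq hf).continuousOn.upperSemicontinuousOn
  circleIntegrable z r hr h := by
    apply ContinuousOn.circleIntegrable hr.le
    exact (contDiffOn_norm_sq hf).continuousOn.mono (sphere_subset_closedBall.trans h)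
  le_circleAverage z r hr h := by
    have hs : sphere z |r| ⊆ unitDisk := by
      rw [abs_of_pos hr]; exact sphere_subset_closedBall.trans h
    have hfc : ContinuousOn f (sphere z |r|) := hf.continuousOn.mono hs
    have hmean : Real.circleAverage f z r = f z := by
      apply DiffContOnCl.circleAverage
      rw [abs_of_pos hr]
      exact DifferentiableOn.diffContOnCl (hf.mono (closure_ball_subset_closedBall.trans h))
    let L : H →L[ℝ] ℝ := Complex.reCLM.comp ((innerSL ℂ (f z)).restrictScalars ℝ)
    have hI0 : CircleIntegrable f z r := ContinuousOn.circleIntegrable' hfc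
    have hI1 : CircleIntegrable (fun w => ‖f w‖ ^ 2) z r :=
      ContinuousOn.circleIntegrable' (hfc.norm.pow 2)
    have hI2 : CircleIntegrable (L ∘ f) z r :=
      ContinuousOn.circleIntegrable' (L.continuous.comp_continuousOn hfc)
    have hL : Real.circleAverage (L ∘ f) z r = ‖f z‖ ^ 2 := by
      rw [ContinuousLinearMap.circleAverage_comp_comm L hI0, hmean]
      simp only [L, ContinuousLinearMap.comp_apply, ContinuousLinearMap.coe_restrictScalars',
        innerSL_apply_apply, Complex.reCLM_apply]
      rw [pow_two, ← inner_self_eq_norm_mul_norm (𝕜 := ℂ)]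
      rfl
    -- `2 Re ⟪f z, f w⟫ - ‖f z‖² ≤ ‖f w‖²`, and the left side has average `‖f z‖²`.
    have hle : Real.circleAverage ((2 : ℝ) • (L ∘ f) - fun _ => ‖f z‖ ^ 2) z r ≤
        Real.circleAverage (fun w => ‖f w‖ ^ 2) z r := by
      apply Real.circleAverage_mono
      · exact (hI2.const_smul).sub (circleIntegrable_const _ _ _)
      · exact hI1
      · intro w _
        have h := norm_sub_sq (𝕜 := ℂ) (f z) (f w)
        have h0 := sq_nonneg ‖f z - f w‖
        simp only [Pi.sub_apply, Pi.smul_apply, Function.comp_apply, L, smul_eq_mul,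
          ContinuousLinearMap.comp_apply, ContinuousLinearMap.coe_restrictScalars',
          innerSL_apply_apply, Complex.reCLM_apply]
        simp only [RCLike.re_to_complex] at h
        linarith
    rw [Real.circleAverage_sub hI2.const_smul (circleIntegrable_const _ _ _),
      Real.circleAverage_smul, hL, Real.circleAverage_const] at hle
    simp only [smul_eq_mul] at hle
    linarith

end SquaredNorm

/-- Cauchy's estimate on the disk of radius `(1 - |z|) / 2` around `z`. -/
lemma norm_deriv_le_of_bounded {F : Type*} [NormedAddCommGroup F] [NormedSpace ℂ F]
    {f : ℂ → F} (hf : DifferentiableOn ℂ f unitDisk) {M : ℝ}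
    (hM : ∀ z ∈ unitDisk, ‖f z‖ ≤ M) {z : ℂ} (hz : z ∈ unitDisk) :
    ‖deriv f z‖ ≤ 2 * M / (1 - ‖z‖) := by
  have hz' := mem_unitDisk.1 hz
  have hsub : closedBall z ((1 - ‖z‖) / 2) ⊆ unitDisk := by
    intro w hw
    rw [mem_closedBall, dist_eq_norm] at hw
    rw [mem_unitDisk]
    have := norm_le_norm_add_norm_sub z w
    rw [norm_sub_rev] at this
    linarith
  have h := Complex.norm_deriv_le_of_forall_mem_sphere_norm_le (f := f) (c := z) (C := M)
    (R := (1 - ‖z‖) / 2) (by linarith)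
    (DifferentiableOn.diffContOnCl (hf.mono (closure_ball_subset_closedBall.trans hsub)))
    (fun w hw => hM w (hsub (sphere_subset_closedBall hw)))
  refine h.trans (le_of_eq ?_)
  have : 1 - ‖z‖ ≠ 0 := by linarith
  field_simp

/-! ### Parseval's identity on circles -/

section Parseval

open Filter Topology Real

variable {H : Type*} [NormedAddCommGroup H] [InnerProductSpace ℂ H]

lemma integral_conj_circleMap_pow_mul_pow (ρ : ℝ) (n m : ℕ) :
    ∫ θ in (-π)..π, (starRingEnd ℂ) (circleMap 0 ρ θ ^ n) * circleMap 0 ρ θ ^ m =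
      if n = m then 2 * π * (ρ : ℂ) ^ (2 * n) else 0 := by
  have key : ∀ θ : ℝ, (starRingEnd ℂ) (circleMap 0 ρ θ ^ n) * circleMap 0 ρ θ ^ m =
      (ρ : ℂ) ^ (n + m) * Complex.exp (((m : ℂ) - n) * Complex.I * θ) := by
    intro θ
    rw [circleMap_zero]
    simp only [map_pow, map_mul, Complex.conj_ofReal, ← Complex.exp_conj, Complex.conj_I,
      map_natCast, mul_pow, ← Complex.exp_nat_mul]
    rw [mul_mul_mul_comm, ← pow_add, ← Complex.exp_add]
    congr 2
    ring
  simp_rw [key]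
  rw [intervalIntegral.integral_const_mul]
  split_ifs with h
  · subst h
    simp
    ring
  · have hne : ((m : ℂ) - n) * Complex.I ≠ 0 := by
      apply mul_ne_zero _ Complex.I_ne_zero
      rw [sub_ne_zero]
      exact_mod_cast Ne.symm h
    rw [integral_exp_mul_complex hne]
    have : Complex.exp (((m : ℂ) - n) * Complex.I * (π : ℝ)) =
        Complex.exp (((m : ℂ) - n) * Complex.I * ((-π : ℝ) : ℂ)) := by
      rw [Complex.exp_eq_exp_iff_exists_int]
      refine ⟨(m : ℤ) - n, ?_⟩
      push_cast
      ring
    rw [this]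
    simp

/-- **Parseval's identity** for polynomials with coefficients in a Hilbert space. -/
lemma integral_norm_sq_sum_circleMap (c : ℕ → H) (N : ℕ) (ρ : ℝ) :
    ∫ θ in (-π)..π, ‖∑ n ∈ Finset.range N, circleMap 0 ρ θ ^ n • c n‖ ^ 2 =
      2 * π * ∑ n ∈ Finset.range N, ‖c n‖ ^ 2 * ρ ^ (2 * n) := by
  have key : ∀ θ : ℝ, ((‖∑ n ∈ Finset.range N, circleMap 0 ρ θ ^ n • c n‖ ^ 2 : ℝ) : ℂ) =
      ∑ n ∈ Finset.range N, ∑ m ∈ Finset.range N,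
        (starRingEnd ℂ) (circleMap 0 ρ θ ^ n) * circleMap 0 ρ θ ^ m * ⟪c n, c m⟫_ℂ := by
    intro θ
    have h := inner_self_eq_norm_sq_to_K (𝕜 := ℂ) (∑ n ∈ Finset.range N, circleMap 0 ρ θ ^ n • c n)
    simp only [Complex.coe_algebraMap] at h
    rw [Complex.ofReal_pow, ← h, sum_inner]
    refine Finset.sum_congr rfl fun n _ => ?_
    rw [inner_sum]
    refine Finset.sum_congr rfl fun m _ => ?_
    rw [inner_smul_left, inner_smul_right]
    ring
  have hcont : ∀ n m : ℕ, Continuous fun θ : ℝ =>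
      (starRingEnd ℂ) (circleMap 0 ρ θ ^ n) * circleMap 0 ρ θ ^ m * ⟪c n, c m⟫_ℂ := by
    intro n m
    have := continuous_circleMap 0 ρ
    exact ((Complex.continuous_conj.comp (this.pow n)).mul (this.pow m)).mul continuous_const
  apply Complex.ofReal_injective
  rw [← intervalIntegral.integral_ofReal]
  simp_rw [key]
  rw [intervalIntegral.integral_finsetSum
    fun n _ => (continuous_finsetSum _ fun m _ => hcont n m).intervalIntegrable _ _]
  push_cast
  rw [Finset.mul_sum]
  refine Finset.sum_congr rfl fun n hn => ?_
  rw [intervalIntegral.integral_finsetSum fun m _ => (hcont n m).intervalIntegrable _ _]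
  simp_rw [intervalIntegral.integral_mul_const, integral_conj_circleMap_pow_mul_pow, ite_mul,
    zero_mul]
  rw [Finset.sum_ite_eq, if_pos hn, inner_self_eq_norm_sq_to_K]
  simp only [Complex.coe_algebraMap]
  ring

/-- **Parseval's identity** on a circle for the sum of a power series in the unit disk. -/
lemma tendsto_sum_norm_sq_mul_pow {f : ℂ → H} {c : ℕ → H}
    (hf : ∀ z ∈ unitDisk, HasSum (fun n => z ^ n • c n) (f z))
    {ρ : ℝ} (h0 : 0 ≤ ρ) (h1 : ρ < 1) :
    Tendsto (fun N => 2 * π * ∑ n ∈ Finset.range N, ‖c n‖ ^ 2 * ρ ^ (2 * n)) atTop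
      (𝓝 (∫ θ in (-π)..π, ‖f (circleMap 0 ρ θ)‖ ^ 2)) := by
  obtain ⟨σ, hσ1, hσ2⟩ := exists_between h1
  have hσ0 : 0 < σ := h0.trans_lt hσ1
  -- The coefficients grow at most like `σ⁻ⁿ`, so the partial sums are uniformly bounded on
  -- the circle of radius `ρ < σ`.
  obtain ⟨B, hB⟩ : ∃ B, ∀ n, ‖c n‖ * σ ^ n ≤ B := by
    have hs := (hf (σ : ℂ) (by rw [mem_unitDisk]; simpa [abs_of_pos hσ0])).summable
    obtain ⟨B, hB⟩ := (hs.tendsto_atTop_zero.norm).bddAbove_range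
    refine ⟨B, fun n => ?_⟩
    have := hB ⟨n, rfl⟩
    simpa [norm_smul, abs_of_pos hσ0, mul_comm] using this
  have hB0 : 0 ≤ B := le_trans (by positivity) (hB 0)
  have hq1 : ρ / σ < 1 := (div_lt_one hσ0).2 hσ1
  have hq0 : 0 ≤ ρ / σ := by positivity
  have hbound : ∀ N θ, ‖∑ n ∈ Finset.range N, circleMap 0 ρ θ ^ n • c n‖ ≤ B * (1 - ρ / σ)⁻¹ := by
    intro N θ
    calc ‖∑ n ∈ Finset.range N, circleMap 0 ρ θ ^ n • c n‖
        ≤ ∑ n ∈ Finset.range N, B * (ρ / σ) ^ n := by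
          refine norm_sum_le_of_le _ fun n _ => ?_
          rw [norm_smul, norm_pow, norm_circleMap_zero, abs_of_nonneg h0, div_pow]
          have := mul_le_mul_of_nonneg_right (hB n) (by positivity : 0 ≤ ρ ^ n / σ ^ n)
          refine le_trans (le_of_eq ?_) this
          field_simp
      _ ≤ B * (1 - ρ / σ)⁻¹ := by
          rw [← Finset.mul_sum, ← tsum_geometric_of_lt_one hq0 hq1]
          gcongr
          exact (summable_geometric_of_lt_one hq0 hq1).sum_le_tsum _ fun _ _ => by positivity
  simp_rw [← integral_norm_sq_sum_circleMap c _ ρ]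
  refine intervalIntegral.tendsto_integral_filter_of_dominated_convergence
    (fun _ => (B * (1 - ρ / σ)⁻¹) ^ 2) ?_ ?_ ?_ ?_
  · refine Eventually.of_forall fun N => Continuous.aestronglyMeasurable ?_
    have := continuous_circleMap 0 ρ
    exact (continuous_finsetSum _ fun n _ => (this.pow n).smul continuous_const).norm.pow 2
  · refine Eventually.of_forall fun N => Eventually.of_forall fun θ _ => ?_
    rw [Real.norm_of_nonneg (by positivity)]
    exact pow_le_pow_left₀ (norm_nonneg _) (hbound N θ) 2
  · exact intervalIntegrable_const
  · refine Eventually.of_forall fun θ _ => ?_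
    have hmem : circleMap 0 ρ θ ∈ unitDisk := by
      rw [mem_unitDisk, norm_circleMap_zero, abs_of_nonneg h0]; exact h1
    exact ((hf _ hmem).tendsto_sum_nat.norm).pow 2

end Parseval

/-! ### The Littlewood–Paley inequality -/

section LittlewoodPaley

open Filter Topology Real

variable {H : Type*} [NormedAddCommGroup H] [InnerProductSpace ℂ H]

/-- Integration of a nonnegative radially weighted function over the unit disk in polar
coordinates. -/
lemma lintegral_unitDisk_eq_lintegral_circleMap {u : ℂ → ℝ} (hu : Continuous u)
    (hu0 : ∀ z, 0 ≤ u z) {w : ℝ → ℝ} (hw : Continuous w) (hw0 : ∀ r ∈ Set.Ioo (0 : ℝ) 1, 0 ≤ w r) :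
    ∫⁻ z in unitDisk, ENNReal.ofReal (u z * w ‖z‖) =
      ∫⁻ r in Set.Ioo (0 : ℝ) 1, ENNReal.ofReal
        (r * w r * ∫ θ in (-π)..π, u (circleMap 0 r θ)) := by
  have hmeas : Measurable (unitDisk.indicator fun z => ENNReal.ofReal (u z * w ‖z‖)) :=
    (ENNReal.measurable_ofReal.comp
      (hu.mul (hw.comp continuous_norm)).measurable).indicator isOpen_unitDisk.measurableSet
  have hsymm : ∀ p : ℝ × ℝ, Complex.polarCoord.symm p = circleMap 0 p.1 p.2 := by
    intro p
    rw [Complex.polarCoord_symm_apply, circleMap_zero, Complex.exp_mul_I]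
    push_cast
    rfl
  have hcirc : Continuous fun p : ℝ × ℝ => circleMap 0 p.1 p.2 := by
    simp only [circleMap_zero]
    fun_prop
  rw [← lintegral_indicator isOpen_unitDisk.measurableSet, ← Complex.lintegral_comp_polarCoord_symm]
  simp_rw [hsymm]
  rw [polarCoord_target, Measure.volume_eq_prod, ← Measure.prod_restrict, lintegral_prod]
  swap
  · apply Measurable.aemeasurable
    exact (ENNReal.measurable_ofReal.comp measurable_fst).smul (hmeas.comp hcirc.measurable)
  have hsub : Set.Ioo (0 : ℝ) 1 ⊆ Set.Ioi 0 := fun x hx => hx.1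
  rw [← lintegral_indicator measurableSet_Ioi, ← lintegral_indicator measurableSet_Ioo]
  congr 1
  ext r
  by_cases hr0 : 0 < r
  swap
  · simp [Set.indicator, hr0]
  rw [Set.indicator_of_mem (by exact hr0)]
  have hnorm : ∀ θ, ‖circleMap 0 r θ‖ = r := fun θ => by
    rw [norm_circleMap_zero, abs_of_pos hr0]
  by_cases hr1 : r < 1
  swap
  · have : ∀ θ, circleMap 0 r θ ∉ unitDisk := fun θ => by
      rw [mem_unitDisk, hnorm]; exact hr1
    simp [this, hr1]
  have hmem : ∀ θ, circleMap 0 r θ ∈ unitDisk := fun θ => by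
    rw [mem_unitDisk, hnorm]; exact hr1
  have hrI : r ∈ Set.Ioo (0 : ℝ) 1 := ⟨hr0, hr1⟩
  rw [Set.indicator_of_mem hrI]
  have hcont : Continuous fun θ => u (circleMap 0 r θ) := hu.comp (continuous_circleMap 0 r)
  have h1 : ∀ θ, ENNReal.ofReal r • unitDisk.indicator (fun z => ENNReal.ofReal (u z * w ‖z‖))
      (circleMap 0 r θ) = ENNReal.ofReal (r * w r) * ENNReal.ofReal (u (circleMap 0 r θ)) := by
    intro θ
    rw [Set.indicator_of_mem (hmem θ), hnorm, smul_eq_mul, ← ENNReal.ofReal_mul hr0.le,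
      ← ENNReal.ofReal_mul (mul_nonneg hr0.le (hw0 r hrI))]
    congr 1
    ring
  simp_rw [h1]
  have hpi : -π ≤ π := by linarith [pi_pos]
  rw [lintegral_const_mul' _ _ ENNReal.ofReal_ne_top,
    ENNReal.ofReal_mul (mul_nonneg hr0.le (hw0 r hrI)), intervalIntegral.integral_of_le hpi,
    integral_Ioc_eq_integral_Ioo, ofReal_integral_eq_lintegral_ofReal]
  · exact (hcont.integrableOn_Icc).mono_set Set.Ioo_subset_Icc_self
  · exact Eventually.of_forall fun θ => hu0 _

/-- The weighted area integral of a polynomial, by Parseval's identity on every circle. -/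
lemma lintegral_norm_sq_sum_pow (c : ℕ → H) (N : ℕ) :
    ∫⁻ z in unitDisk, ENNReal.ofReal
        (‖∑ n ∈ Finset.range N, z ^ n • c n‖ ^ 2 * (1 - ‖z‖ ^ 2)) =
      ENNReal.ofReal (π * ∑ n ∈ Finset.range N, ‖c n‖ ^ 2 / ((n + 1) * (n + 2))) := by
  have hu : Continuous fun z : ℂ => ‖∑ n ∈ Finset.range N, z ^ n • c n‖ ^ 2 :=
    (continuous_finsetSum _ fun n _ => (continuous_pow n).smul continuous_const).norm.pow 2
  rw [lintegral_unitDisk_eq_lintegral_circleMap hu (fun z => by positivity)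
    (w := fun r => 1 - r ^ 2) (by fun_prop) (fun r hr => by nlinarith [hr.1, hr.2])]
  simp_rw [integral_norm_sq_sum_circleMap]
  have hcont : Continuous fun r : ℝ =>
      r * (1 - r ^ 2) * (2 * π * ∑ n ∈ Finset.range N, ‖c n‖ ^ 2 * r ^ (2 * n)) := by fun_prop
  rw [← ofReal_integral_eq_lintegral_ofReal
    ((hcont.integrableOn_Icc).mono_set Set.Ioo_subset_Icc_self)
    ((ae_restrict_iff' measurableSet_Ioo).2 (Eventually.of_forall fun r hr => ?_))]
  swap
  · have h1 : 0 ≤ 1 - r ^ 2 := by nlinarith [hr.1, hr.2]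
    have h2 := hr.1.le
    have h3 := pi_pos
    simp only [Pi.zero_apply]
    positivity
  rw [← integral_Ioc_eq_integral_Ioo, ← intervalIntegral.integral_of_le zero_le_one]
  congr 1
  have h2 : ∀ r : ℝ, r * (1 - r ^ 2) * (2 * π * ∑ n ∈ Finset.range N, ‖c n‖ ^ 2 * r ^ (2 * n)) =
      ∑ n ∈ Finset.range N, 2 * π * ‖c n‖ ^ 2 * (r ^ (2 * n + 1) - r ^ (2 * n + 3)) := by
    intro r
    rw [Finset.mul_sum, Finset.mul_sum]
    refine Finset.sum_congr rfl fun n _ => ?_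
    ring
  simp_rw [h2]
  rw [intervalIntegral.integral_finsetSum
    fun n _ => (Continuous.intervalIntegrable (by fun_prop) _ _), Finset.mul_sum]
  refine Finset.sum_congr rfl fun n _ => ?_
  rw [intervalIntegral.integral_const_mul, intervalIntegral.integral_sub
    (Continuous.intervalIntegrable (by fun_prop) _ _)
    (Continuous.intervalIntegrable (by fun_prop) _ _), integral_pow, integral_pow]
  have hx : (0 : ℝ) ≤ n := n.cast_nonneg
  rw [one_pow, one_pow, zero_pow (Nat.succ_ne_zero _), zero_pow (Nat.succ_ne_zero _)]
  push_cast
  generalize (n : ℝ) = x, ‖c n‖ ^ 2 = y at hx ⊢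
  rw [show 2 * x + 1 + 1 = 2 * (x + 1) by ring, show 2 * x + 3 + 1 = 2 * (x + 2) by ring]
  have h3 : x + 1 ≠ 0 := by positivity
  have h4 : x + 2 ≠ 0 := by positivity
  field_simp
  ring

/-- The Taylor coefficients of `f` at the origin. -/
noncomputable def taylorCoeff {F : Type*} [NormedAddCommGroup F] [NormedSpace ℂ F]
    (f : ℂ → F) (n : ℕ) : F :=
  ((n.factorial : ℂ)⁻¹) • iteratedDeriv n f 0

lemma hasSum_taylorCoeff {F : Type*} [NormedAddCommGroup F] [NormedSpace ℂ F] [CompleteSpace F]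
    {f : ℂ → F} (hf : DifferentiableOn ℂ f unitDisk) {z : ℂ} (hz : z ∈ unitDisk) :
    HasSum (fun n => z ^ n • taylorCoeff f n) (f z) := by
  convert Complex.hasSum_taylorSeries_on_ball hf hz using 2 with n
  rw [taylorCoeff, smul_comm, sub_zero]

lemma taylorCoeff_deriv {F : Type*} [NormedAddCommGroup F] [NormedSpace ℂ F]
    (f : ℂ → F) (n : ℕ) : taylorCoeff (deriv f) n = ((n : ℂ) + 1) • taylorCoeff f (n + 1) := by
  rw [taylorCoeff, taylorCoeff, iteratedDeriv_succ', smul_smul, Nat.factorial_succ]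
  congr 1
  have h1 : ((n : ℂ) + 1) ≠ 0 := by exact_mod_cast n.succ_ne_zero
  push_cast
  field_simp

/-- Bessel's inequality for the Taylor coefficients of a function in the Hardy space `H²`. -/
lemma sum_norm_sq_taylorCoeff_le [CompleteSpace H] {f : ℂ → H}
    (hf : DifferentiableOn ℂ f unitDisk)
    {B : ℝ} (hB : ∀ ρ ∈ Set.Ioo (0 : ℝ) 1, ∫ θ in (-π)..π, ‖f (circleMap 0 ρ θ)‖ ^ 2 ≤ 2 * π * B)
    (N : ℕ) : ∑ n ∈ Finset.range N, ‖taylorCoeff f n‖ ^ 2 ≤ B := by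
  have hρ : ∀ ρ ∈ Set.Ioo (0 : ℝ) 1,
      ∑ n ∈ Finset.range N, ‖taylorCoeff f n‖ ^ 2 * ρ ^ (2 * n) ≤ B := by
    intro ρ hρ
    have hmono : Monotone fun N => 2 * π * ∑ n ∈ Finset.range N,
        ‖taylorCoeff f n‖ ^ 2 * ρ ^ (2 * n) := by
      intro a b hab
      have := hρ.1
      have := pi_pos
      dsimp only
      gcongr
    have h := (hmono.ge_of_tendsto (tendsto_sum_norm_sq_mul_pow
      (fun z hz => hasSum_taylorCoeff hf hz) hρ.1.le hρ.2) N).trans (hB ρ hρ)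
    exact le_of_mul_le_mul_left h (by positivity)
  have hcont : Continuous fun ρ : ℝ =>
      ∑ n ∈ Finset.range N, ‖taylorCoeff f n‖ ^ 2 * ρ ^ (2 * n) := by fun_prop
  have hlim := (hcont.tendsto 1).mono_left (nhdsWithin_le_nhds (s := Set.Iio 1))
  simp only [one_pow, mul_one] at hlim
  refine le_of_tendsto hlim ?_
  filter_upwards [Ioo_mem_nhdsLT (zero_lt_one (α := ℝ))] with ρ h using hρ ρ h

/-- The **Littlewood–Paley inequality** for functions in the Hardy space `H²` with values in a
Hilbert space. -/
lemma lintegral_norm_sq_deriv_le [CompleteSpace H] {f : ℂ → H}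
    (hf : DifferentiableOn ℂ f unitDisk)
    {B : ℝ} (hB : ∀ ρ ∈ Set.Ioo (0 : ℝ) 1, ∫ θ in (-π)..π, ‖f (circleMap 0 ρ θ)‖ ^ 2 ≤ 2 * π * B) :
    ∫⁻ z in unitDisk, ENNReal.ofReal (‖deriv f z‖ ^ 2 * (1 - ‖z‖ ^ 2)) ≤
      ENNReal.ofReal (π * B) := by
  set c : ℕ → H := taylorCoeff (deriv f) with hc
  have hconv : ∀ z ∈ unitDisk, Tendsto (fun N => ENNReal.ofReal
      (‖∑ n ∈ Finset.range N, z ^ n • c n‖ ^ 2 * (1 - ‖z‖ ^ 2))) atTop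
      (𝓝 (ENNReal.ofReal (‖deriv f z‖ ^ 2 * (1 - ‖z‖ ^ 2)))) := by
    intro z hz
    refine ENNReal.tendsto_ofReal (Tendsto.mul_const _ ?_)
    exact ((hasSum_taylorCoeff (hf.deriv isOpen_unitDisk) hz).tendsto_sum_nat.norm).pow 2
  have hpart : ∀ N, ∫⁻ z in unitDisk, ENNReal.ofReal
      (‖∑ n ∈ Finset.range N, z ^ n • c n‖ ^ 2 * (1 - ‖z‖ ^ 2)) ≤ ENNReal.ofReal (π * B) := by
    intro N
    rw [lintegral_norm_sq_sum_pow]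
    refine ENNReal.ofReal_le_ofReal (mul_le_mul_of_nonneg_left ?_ pi_pos.le)
    refine le_trans ?_ (sum_norm_sq_taylorCoeff_le hf hB (N + 1))
    rw [Finset.sum_range_succ']
    refine le_trans (Finset.sum_le_sum fun n _ => ?_) (le_add_of_nonneg_right (by positivity))
    rw [hc, taylorCoeff_deriv, norm_smul, mul_pow]
    have h1 : ‖(n : ℂ) + 1‖ = n + 1 := by
      exact_mod_cast Complex.norm_natCast (n + 1)
    rw [h1, div_le_iff₀ (by positivity)]
    have h2 : 0 ≤ ‖taylorCoeff f (n + 1)‖ ^ 2 := by positivity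
    have h3 : ((n : ℝ) + 1) ^ 2 ≤ (n + 1) * (n + 2) := by nlinarith [(n.cast_nonneg : (0 : ℝ) ≤ n)]
    nlinarith
  calc ∫⁻ z in unitDisk, ENNReal.ofReal (‖deriv f z‖ ^ 2 * (1 - ‖z‖ ^ 2))
      = ∫⁻ z in unitDisk, liminf (fun N => ENNReal.ofReal
          (‖∑ n ∈ Finset.range N, z ^ n • c n‖ ^ 2 * (1 - ‖z‖ ^ 2))) atTop :=
        setLIntegral_congr_fun isOpen_unitDisk.measurableSet fun z hz => (hconv z hz).liminf_eq.symm
    _ ≤ liminf (fun N => ∫⁻ z in unitDisk, ENNReal.ofReal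
          (‖∑ n ∈ Finset.range N, z ^ n • c n‖ ^ 2 * (1 - ‖z‖ ^ 2))) atTop := by
        refine lintegral_liminf_le fun N =>
          ENNReal.measurable_ofReal.comp (Continuous.measurable ?_)
        have : Continuous fun z : ℂ => ∑ n ∈ Finset.range N, z ^ n • c n :=
          continuous_finsetSum _ fun n _ => (continuous_pow n).smul continuous_const
        fun_prop
    _ ≤ ENNReal.ofReal (π * B) :=
        (liminf_le_liminf (Eventually.of_forall hpart)).trans (liminf_const _).le

end LittlewoodPaley

/-! ### Derivatives of bounded holomorphic functions and Carleson measures -/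

section Carleson

open Filter Topology Real

variable {H : Type*} [NormedAddCommGroup H] [InnerProductSpace ℂ H]

/-- The Szegő kernel `k_a(z) = (1 - ā z)⁻¹` of the unit disk. -/
noncomputable def szegoKernel (a z : ℂ) : ℂ := (1 - (starRingEnd ℂ) a * z)⁻¹

lemma one_sub_conj_mul_ne_zero {a z : ℂ} (ha : a ∈ unitDisk) (hz : z ∈ unitDisk) :
    1 - (starRingEnd ℂ) a * z ≠ 0 := by
  rw [mem_unitDisk] at ha hz
  intro h
  have h1 : ‖(starRingEnd ℂ) a * z‖ = 1 := by rw [← sub_eq_zero.1 h, norm_one]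
  rw [norm_mul, RCLike.norm_conj] at h1
  nlinarith [norm_nonneg a, norm_nonneg z]

lemma hasDerivAt_szegoKernel {a z : ℂ} (ha : a ∈ unitDisk) (hz : z ∈ unitDisk) :
    HasDerivAt (szegoKernel a) ((starRingEnd ℂ) a * szegoKernel a z ^ 2) z := by
  have h := (((hasDerivAt_id z).const_mul ((starRingEnd ℂ) a)).const_sub 1).inv
    (one_sub_conj_mul_ne_zero ha hz)
  refine h.congr_deriv ?_
  simp [szegoKernel, div_eq_mul_inv]

lemma differentiableOn_szegoKernel {a : ℂ} (ha : a ∈ unitDisk) :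
    DifferentiableOn ℂ (szegoKernel a) unitDisk := fun _ hz =>
  (hasDerivAt_szegoKernel ha hz).differentiableAt.differentiableWithinAt

lemma hasSum_szegoKernel {a z : ℂ} (ha : a ∈ unitDisk) (hz : z ∈ unitDisk) :
    HasSum (fun n => z ^ n • (starRingEnd ℂ) a ^ n) (szegoKernel a z) := by
  rw [mem_unitDisk] at ha hz
  have h1 : ‖(starRingEnd ℂ) a * z‖ < 1 := by
    rw [norm_mul, RCLike.norm_conj]
    nlinarith [norm_nonneg a, norm_nonneg z]
  simpa only [szegoKernel, mul_pow, smul_eq_mul, mul_comm] using hasSum_geometric_of_norm_lt_one h1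

lemma integral_norm_sq_szegoKernel_le {a : ℂ} (ha : a ∈ unitDisk) {ρ : ℝ}
    (hρ : ρ ∈ Set.Ioo (0 : ℝ) 1) :
    ∫ θ in (-π)..π, ‖szegoKernel a (circleMap 0 ρ θ)‖ ^ 2 ≤ 2 * π * (1 - ‖a‖ ^ 2)⁻¹ := by
  have hpi := pi_pos
  have ha' := mem_unitDisk.1 ha
  have ha2 : ‖a‖ ^ 2 < 1 := by nlinarith [norm_nonneg a]
  refine le_of_tendsto' (tendsto_sum_norm_sq_mul_pow
    (fun z hz => hasSum_szegoKernel ha hz) hρ.1.le hρ.2) fun N => ?_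
  refine mul_le_mul_of_nonneg_left ?_ (by positivity)
  rw [← tsum_geometric_of_lt_one (by positivity) ha2]
  refine le_trans (Finset.sum_le_sum fun n _ => ?_)
    ((summable_geometric_of_lt_one (by positivity) ha2).sum_le_tsum (Finset.range N)
      fun _ _ => by positivity)
  rw [norm_pow, RCLike.norm_conj, ← pow_mul, ← pow_mul, mul_comm n 2]
  exact mul_le_of_le_one_right (by positivity) (pow_le_one₀ hρ.1.le hρ.2.le)

/-- The conformally invariant form of the Littlewood–Paley inequality: since
`k_a f' = (k_a f)' - k_a' f`, it follows from the inequality for `k_a f` and for `k_a`. -/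
lemma lintegral_szegoKernel_mul_deriv_le [CompleteSpace H] {f : ℂ → H}
    (hf : DifferentiableOn ℂ f unitDisk) {K : ℝ} (hK : ∀ z ∈ unitDisk, ‖f z‖ ≤ K)
    {a : ℂ} (ha : a ∈ unitDisk) :
    ∫⁻ z in unitDisk, ENNReal.ofReal (‖szegoKernel a z‖ ^ 2 * ‖deriv f z‖ ^ 2 * (1 - ‖z‖ ^ 2)) ≤
      ENNReal.ofReal (4 * π * K ^ 2 * (1 - ‖a‖ ^ 2)⁻¹) := by
  have hpi := pi_pos
  have ha' := mem_unitDisk.1 ha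
  have ha2 : 0 < 1 - ‖a‖ ^ 2 := by nlinarith [norm_nonneg a]
  have hK0 : 0 ≤ K := (norm_nonneg _).trans (hK 0 (by simp [mem_unitDisk]))
  have hk := differentiableOn_szegoKernel ha
  set g : ℂ → H := fun z => szegoKernel a z • f z with hg_def
  have hg : DifferentiableOn ℂ g unitDisk := hk.smul hf
  have hcirc : ∀ ρ ∈ Set.Ioo (0 : ℝ) 1, ∀ θ, circleMap 0 ρ θ ∈ unitDisk := by
    intro ρ hρ θ
    rw [mem_unitDisk, norm_circleMap_zero, abs_of_pos hρ.1]
    exact hρ.2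
  have hgB : ∀ ρ ∈ Set.Ioo (0 : ℝ) 1, ∫ θ in (-π)..π, ‖g (circleMap 0 ρ θ)‖ ^ 2 ≤
      2 * π * (K ^ 2 * (1 - ‖a‖ ^ 2)⁻¹) := by
    intro ρ hρ
    have hcomp : ∀ {F : Type _} [NormedAddCommGroup F] [NormedSpace ℂ F] {h : ℂ → F},
        DifferentiableOn ℂ h unitDisk → Continuous fun θ => h (circleMap 0 ρ θ) :=
      fun hh => hh.continuousOn.comp_continuous (continuous_circleMap 0 ρ) (hcirc ρ hρ)
    calc ∫ θ in (-π)..π, ‖g (circleMap 0 ρ θ)‖ ^ 2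
        ≤ ∫ θ in (-π)..π, K ^ 2 * ‖szegoKernel a (circleMap 0 ρ θ)‖ ^ 2 := by
          refine intervalIntegral.integral_mono_on (by linarith)
            (((hcomp hg).norm.pow 2).intervalIntegrable _ _)
            ((continuous_const.mul ((hk.continuousOn.comp_continuous (continuous_circleMap 0 ρ)
              (hcirc ρ hρ)).norm.pow 2)).intervalIntegrable _ _) fun θ _ => ?_
          rw [hg_def, norm_smul, mul_pow, mul_comm]
          have := hK _ (hcirc ρ hρ θ)
          gcongr
      _ ≤ 2 * π * (K ^ 2 * (1 - ‖a‖ ^ 2)⁻¹) := by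
          rw [intervalIntegral.integral_const_mul]
          have := mul_le_mul_of_nonneg_left (integral_norm_sq_szegoKernel_le ha hρ) (sq_nonneg K)
          linarith
  have hpt : ∀ z ∈ unitDisk,
      ENNReal.ofReal (‖szegoKernel a z‖ ^ 2 * ‖deriv f z‖ ^ 2 * (1 - ‖z‖ ^ 2)) ≤
      2 * ENNReal.ofReal (‖deriv g z‖ ^ 2 * (1 - ‖z‖ ^ 2)) +
        ENNReal.ofReal (2 * K ^ 2) *
          ENNReal.ofReal (‖deriv (szegoKernel a) z‖ ^ 2 * (1 - ‖z‖ ^ 2)) := by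
    intro z hz
    have hz' := mem_unitDisk.1 hz
    have hz2 : 0 ≤ 1 - ‖z‖ ^ 2 := by nlinarith [norm_nonneg z]
    have hgd : deriv g z = szegoKernel a z • deriv f z + deriv (szegoKernel a) z • f z :=
      deriv_fun_smul (hk.differentiableAt (unitDisk_mem_nhds hz))
        (hf.differentiableAt (unitDisk_mem_nhds hz))
    have h1 : ‖szegoKernel a z‖ * ‖deriv f z‖ ≤
        ‖deriv g z‖ + K * ‖deriv (szegoKernel a) z‖ := by
      have : szegoKernel a z • deriv f z = deriv g z - deriv (szegoKernel a) z • f z := by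
        rw [hgd, add_sub_cancel_right]
      rw [← norm_smul, this]
      refine (norm_sub_le _ _).trans ?_
      rw [norm_smul, mul_comm K]
      have := hK z hz
      gcongr
    have h2 : ‖szegoKernel a z‖ ^ 2 * ‖deriv f z‖ ^ 2 ≤
        2 * ‖deriv g z‖ ^ 2 + 2 * K ^ 2 * ‖deriv (szegoKernel a) z‖ ^ 2 := by
      have h3 := pow_le_pow_left₀ (by positivity) h1 2
      have h4 := sq_nonneg (‖deriv g z‖ - K * ‖deriv (szegoKernel a) z‖)
      nlinarith
    have h2' : (2 : ℝ≥0∞) = ENNReal.ofReal 2 := by simp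
    rw [h2', ← ENNReal.ofReal_mul (by positivity), ← ENNReal.ofReal_mul (by positivity),
      ← ENNReal.ofReal_add (by positivity) (by positivity)]
    refine ENNReal.ofReal_le_ofReal ?_
    have := mul_le_mul_of_nonneg_right h2 hz2
    linarith
  calc ∫⁻ z in unitDisk, ENNReal.ofReal (‖szegoKernel a z‖ ^ 2 * ‖deriv f z‖ ^ 2 * (1 - ‖z‖ ^ 2))
      ≤ ∫⁻ z in unitDisk, (2 * ENNReal.ofReal (‖deriv g z‖ ^ 2 * (1 - ‖z‖ ^ 2)) +
          ENNReal.ofReal (2 * K ^ 2) *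
            ENNReal.ofReal (‖deriv (szegoKernel a) z‖ ^ 2 * (1 - ‖z‖ ^ 2))) :=
        setLIntegral_mono' isOpen_unitDisk.measurableSet hpt
    _ = 2 * (∫⁻ z in unitDisk, ENNReal.ofReal (‖deriv g z‖ ^ 2 * (1 - ‖z‖ ^ 2))) +
          ENNReal.ofReal (2 * K ^ 2) * ∫⁻ z in unitDisk,
            ENNReal.ofReal (‖deriv (szegoKernel a) z‖ ^ 2 * (1 - ‖z‖ ^ 2)) := by
        rw [lintegral_add_left', lintegral_const_mul' _ _ (by simp),
          lintegral_const_mul' _ _ ENNReal.ofReal_ne_top]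
        refine AEMeasurable.const_mul (ENNReal.measurable_ofReal.comp_aemeasurable ?_) _
        refine ContinuousOn.aemeasurable ?_ isOpen_unitDisk.measurableSet
        have := (hg.deriv isOpen_unitDisk).continuousOn
        fun_prop
    _ ≤ 2 * ENNReal.ofReal (π * (K ^ 2 * (1 - ‖a‖ ^ 2)⁻¹)) +
          ENNReal.ofReal (2 * K ^ 2) * ENNReal.ofReal (π * (1 - ‖a‖ ^ 2)⁻¹) := by
        gcongr
        · exact lintegral_norm_sq_deriv_le hg hgB
        · exact lintegral_norm_sq_deriv_le hk fun ρ hρ => integral_norm_sq_szegoKernel_le ha hρ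
    _ = ENNReal.ofReal (4 * π * K ^ 2 * (1 - ‖a‖ ^ 2)⁻¹) := by
        have h2' : (2 : ℝ≥0∞) = ENNReal.ofReal 2 := by simp
        rw [h2', ← ENNReal.ofReal_mul (by positivity), ← ENNReal.ofReal_mul (by positivity),
          ← ENNReal.ofReal_add (by positivity) (by positivity)]
        congr 1
        ring

/-- For a bounded holomorphic Hilbert space valued function `f`, the measure
`‖f'‖² (1 - |z|) dx dy` is Carleson. -/
lemma lintegral_ball_norm_sq_deriv_le [CompleteSpace H] {f : ℂ → H}
    (hf : DifferentiableOn ℂ f unitDisk) {K : ℝ} (hK : ∀ z ∈ unitDisk, ‖f z‖ ≤ K)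
    {ξ : ℂ} (hξ : ‖ξ‖ = 1) {r : ℝ} (hr : 0 < r) :
    ∫⁻ z in ball ξ r ∩ unitDisk, ENNReal.ofReal (‖deriv f z‖ ^ 2 * (1 - ‖z‖)) ≤
      ENNReal.ofReal (16 * π * K ^ 2 * r) := by
  have hpi := pi_pos
  -- The kernel `k_a` with `a = (1 - s) ξ` is at least `1 / (2 s)` on the part of the disk within
  -- distance `s` of `ξ`; for `r ≥ 1` the choice `s = 1`, that is `k_a = 1`, suffices.
  set s := min r 1 with hs_def
  have hs0 : 0 < s := lt_min hr one_pos
  have hs1 : s ≤ 1 := min_le_right _ _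
  have hsr : s ≤ r := min_le_left _ _
  set a : ℂ := ((1 - s : ℝ) : ℂ) * ξ with ha_def
  have hna : ‖a‖ = 1 - s := by
    rw [ha_def, norm_mul, hξ, mul_one, Complex.norm_real, Real.norm_of_nonneg (by linarith)]
  have ha : a ∈ unitDisk := by rw [mem_unitDisk, hna]; linarith
  have hξξ : (starRingEnd ℂ) ξ * ξ = 1 := by
    rw [← Complex.normSq_eq_conj_mul_self, Complex.normSq_eq_norm_sq, hξ]; simp
  have hden : ∀ z ∈ ball ξ r ∩ unitDisk, ‖1 - (starRingEnd ℂ) a * z‖ ≤ 2 * s := by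
    rintro z ⟨hz1, hz2⟩
    rw [mem_unitDisk] at hz2
    rw [mem_ball, dist_eq_norm] at hz1
    rcases le_total r 1 with h | h
    · have hsr' : s = r := min_eq_left h
      have : 1 - (starRingEnd ℂ) a * z =
          (starRingEnd ℂ) ξ * (ξ - z) + (s : ℂ) * ((starRingEnd ℂ) ξ * z) := by
        rw [ha_def, map_mul, Complex.conj_ofReal, mul_sub, hξξ]
        push_cast
        ring
      rw [this]
      refine (norm_add_le _ _).trans ?_
      rw [norm_mul, norm_mul, norm_mul, RCLike.norm_conj, hξ, norm_sub_rev, Complex.norm_real,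
        Real.norm_of_nonneg hs0.le]
      nlinarith
    · have hs' : s = 1 := min_eq_right h
      rw [ha_def, hs']
      simp
  have hpt : ∀ z ∈ ball ξ r ∩ unitDisk, ENNReal.ofReal (‖deriv f z‖ ^ 2 * (1 - ‖z‖)) ≤
      ENNReal.ofReal (4 * s ^ 2) *
        ENNReal.ofReal (‖szegoKernel a z‖ ^ 2 * ‖deriv f z‖ ^ 2 * (1 - ‖z‖ ^ 2)) := by
    intro z hz
    have hz' := mem_unitDisk.1 hz.2
    rw [← ENNReal.ofReal_mul (by positivity)]
    refine ENNReal.ofReal_le_ofReal ?_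
    have hpos : 0 < ‖1 - (starRingEnd ℂ) a * z‖ :=
      norm_pos_iff.2 (one_sub_conj_mul_ne_zero ha hz.2)
    have h1 : 1 ≤ 4 * s ^ 2 * ‖szegoKernel a z‖ ^ 2 := by
      rw [szegoKernel, norm_inv, inv_pow, ← div_eq_mul_inv, le_div_iff₀ (by positivity)]
      nlinarith [hden z hz]
    have h2 : 0 ≤ ‖deriv f z‖ ^ 2 * (1 - ‖z‖) := mul_nonneg (sq_nonneg _) (by linarith)
    have h3 : ‖deriv f z‖ ^ 2 * (1 - ‖z‖) ≤ ‖deriv f z‖ ^ 2 * (1 - ‖z‖ ^ 2) := by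
      refine mul_le_mul_of_nonneg_left ?_ (sq_nonneg _)
      nlinarith [norm_nonneg z]
    have h4 := mul_le_mul_of_nonneg_right h1 (h2.trans h3)
    linarith
  calc ∫⁻ z in ball ξ r ∩ unitDisk, ENNReal.ofReal (‖deriv f z‖ ^ 2 * (1 - ‖z‖))
      ≤ ∫⁻ z in ball ξ r ∩ unitDisk, ENNReal.ofReal (4 * s ^ 2) *
        ENNReal.ofReal (‖szegoKernel a z‖ ^ 2 * ‖deriv f z‖ ^ 2 * (1 - ‖z‖ ^ 2)) :=
        setLIntegral_mono' (measurableSet_ball.inter isOpen_unitDisk.measurableSet) hpt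
    _ ≤ ∫⁻ z in unitDisk, ENNReal.ofReal (4 * s ^ 2) *
        ENNReal.ofReal (‖szegoKernel a z‖ ^ 2 * ‖deriv f z‖ ^ 2 * (1 - ‖z‖ ^ 2)) :=
        lintegral_mono_set Set.inter_subset_right
    _ ≤ ENNReal.ofReal (4 * s ^ 2) * ENNReal.ofReal (4 * π * K ^ 2 * (1 - ‖a‖ ^ 2)⁻¹) := by
        rw [lintegral_const_mul' _ _ ENNReal.ofReal_ne_top]
        gcongr
        exact lintegral_szegoKernel_mul_deriv_le hf hK ha
    _ ≤ ENNReal.ofReal (16 * π * K ^ 2 * r) := by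
        rw [← ENNReal.ofReal_mul (by positivity)]
        refine ENNReal.ofReal_le_ofReal ?_
        have h1 : s ≤ 1 - ‖a‖ ^ 2 := by rw [hna]; nlinarith
        have h2 : (1 - ‖a‖ ^ 2)⁻¹ ≤ s⁻¹ := inv_anti₀ hs0 h1
        calc 4 * s ^ 2 * (4 * π * K ^ 2 * (1 - ‖a‖ ^ 2)⁻¹)
            ≤ 4 * s ^ 2 * (4 * π * K ^ 2 * s⁻¹) := by gcongr
          _ = 16 * π * K ^ 2 * s := by field_simp; ring
          _ ≤ 16 * π * K ^ 2 * r := by gcongr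

end Carleson

/-! ### Idempotents and orthogonal projections with the same range -/

section Idempotents

lemma isUnit_one_add_star_mul_self {A : Type*} [CStarAlgebra A] (d : A) :
    IsUnit (1 + star d * d) := by
  by_contra h
  have hmem : (-1 : ℝ) ∈ spectrum ℝ (star d * d) := by
    rw [spectrum.mem_iff]
    intro h'
    apply h
    have : 1 + star d * d = -(algebraMap ℝ A (-1) - star d * d) := by simp; abel
    rw [this]
    exact h'.neg
  have := spectrum_star_mul_self_nonneg _ hmem
  linarith

/-- If `p` is an idempotent, then `p + p* - 1` is a self-adjoint element whose square is
`1 + (p* - p)* (p* - p) ≥ 1`. -/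
lemma isUnit_add_star_sub_one {A : Type*} [CStarAlgebra A] {p : A}
    (hp : p * p = p) : IsUnit (p + star p - 1) := by
  have hp' : star p * star p = star p := by rw [← star_mul, hp]
  have h : (p + star p - 1) * (p + star p - 1) = 1 + star (star p - p) * (star p - p) := by
    simp only [star_sub, star_star, mul_sub, sub_mul, add_mul, mul_add, hp, hp', one_mul, mul_one]
    abel
  have h2 : IsUnit ((p + star p - 1) * (p + star p - 1)) := by
    rw [h]; exact isUnit_one_add_star_mul_self _
  exact ((Commute.refl _).isUnit_mul_iff.1 h2).1

/-- The orthogonal projection `q` with the same range as the idempotent `p` is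
`p (p + p* - 1)⁻¹`. -/
lemma eq_mul_inverse_add_star_sub_one {A : Type*} [CStarAlgebra A] {p q : A}
    (hp : p * p = p) (hq : IsStarProjection q) (hqp : q * p = p) (hpq : p * q = q) :
    q = p * Ring.inverse (p + star p - 1) := by
  have hqs : star q = q := hq.isSelfAdjoint
  have h1 : q * star p = q := by
    have := congrArg star hpq
    rwa [star_mul, hqs] at this
  have h2 : q * (p + star p - 1) = p := by
    rw [mul_sub, mul_add, hqp, h1, mul_one, add_sub_cancel_right]
  exact (Ring.eq_mul_inverse_iff_mul_eq _ _ _ (isUnit_add_star_sub_one hp)).2 h2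

variable {E : Type*} [NormedAddCommGroup E] [InnerProductSpace ℂ E]

lemma mul_eq_right_of_ran_le {a b : E →L[ℂ] E} (ha : a * a = a) (h : ran b ≤ ran a) :
    a * b = b := by
  ext x
  obtain ⟨y, hy⟩ := h (LinearMap.mem_range_self (b : E →ₗ[ℂ] E) x)
  simp only [ContinuousLinearMap.coe_coe] at hy
  rw [mul_apply_eq_comp, ← hy, ← mul_apply_eq_comp, ha]

lemma rank_ran_le_of_norm_sub_lt_one {p q : E →L[ℂ] E} (hq : q * q = q) (h : ‖p - q‖ < 1) :
    Module.rank ℂ (ran q) ≤ Module.rank ℂ (ran p) := by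
  let T : ran q →ₗ[ℂ] ran p :=
    ((p : E →ₗ[ℂ] E).rangeRestrict).comp (ran q).subtype
  refine LinearMap.rank_le_of_injective T ?_
  rw [← LinearMap.ker_eq_bot, LinearMap.ker_eq_bot']
  rintro ⟨x, hx⟩ hTx
  have hpx : p x = 0 := congrArg Subtype.val hTx
  obtain ⟨y, hy⟩ := hx
  have hqx : q x = x := by
    rw [← hy]
    exact congrArg (fun a : E →L[ℂ] E => a y) hq
  have h1 : ‖x‖ ≤ ‖p - q‖ * ‖x‖ := by
    have := (p - q).le_opNorm x
    rwa [_root_.sub_apply, hpx, hqx, zero_sub, norm_neg] at this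
  have h2 : ‖x‖ = 0 := by
    by_contra h0
    have : 0 < ‖x‖ := lt_of_le_of_ne (norm_nonneg x) (Ne.symm h0)
    nlinarith
  exact Subtype.ext (norm_eq_zero.1 h2)

/-- The rank of a continuous family of idempotents is constant. -/
lemma rank_ran_eq_of_continuousOn {P : ℂ → E →L[ℂ] E} (hP : ContinuousOn P unitDisk)
    (hidem : ∀ z ∈ unitDisk, P z * P z = P z) {z w : ℂ} (hz : z ∈ unitDisk) (hw : w ∈ unitDisk) :
    Module.rank ℂ (ran (P z)) = Module.rank ℂ (ran (P w)) := by
  have : PreconnectedSpace unitDisk :=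
    Subtype.preconnectedSpace (convex_ball (0 : ℂ) 1).isPreconnected
  have hloc : IsLocallyConstant fun x : unitDisk => Module.rank ℂ (ran (P x)) := by
    rw [IsLocallyConstant.iff_eventually_eq]
    intro x
    have hc : ContinuousAt (fun y : unitDisk => P y) x :=
      (continuousOn_iff_continuous_domRestrict.1 hP).continuousAt
    filter_upwards [hc.eventually (Metric.ball_mem_nhds _ one_pos)] with y hy
    rw [dist_eq_norm] at hy
    refine le_antisymm (rank_ran_le_of_norm_sub_lt_one (hidem y y.2) ?_)
      (rank_ran_le_of_norm_sub_lt_one (hidem x x.2) hy)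
    rwa [norm_sub_rev]
  exact hloc.apply_eq_of_preconnectedSpace ⟨z, hz⟩ ⟨w, hw⟩

lemma finiteDimensional_ran_of_continuousOn {P : ℂ → E →L[ℂ] E} (hP : ContinuousOn P unitDisk)
    (hidem : ∀ z ∈ unitDisk, P z * P z = P z) {z w : ℂ} (hz : z ∈ unitDisk) (hw : w ∈ unitDisk)
    (h : FiniteDimensional ℂ (ran (P z))) : FiniteDimensional ℂ (ran (P w)) := by
  rw [FiniteDimensional, ← Module.rank_lt_aleph0_iff] at h ⊢
  rwa [← rank_ran_eq_of_continuousOn hP hidem hz hw]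

lemma finiteDimensional_ran_one_sub {p : E →L[ℂ] E} (hp : p * p = p)
    (h : FiniteDimensional ℂ (E ⧸ ran p)) : FiniteDimensional ℂ (ran (1 - p)) := by
  have hker : LinearMap.ker ((1 - p : E →L[ℂ] E) : E →ₗ[ℂ] E) = ran p := by
    ext x
    simp only [LinearMap.mem_ker, ContinuousLinearMap.coe_coe, _root_.sub_apply,
      one_apply_eq_self, LinearMap.mem_range, sub_eq_zero]
    constructor
    · intro hx; exact ⟨x, hx.symm⟩
    · rintro ⟨y, rfl⟩
      exact (congrArg (fun a : E →L[ℂ] E => a y) hp).symm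
  have e := (Submodule.quotEquivOfEq _ _ hker).symm.trans
    (LinearMap.quotKerEquivRange ((1 - p : E →L[ℂ] E) : E →ₗ[ℂ] E))
  exact Module.Finite.equiv e

end Idempotents

/-! ### Hilbert–Schmidt norms of holomorphic operator functions -/

section HilbertSchmidt

open Filter Topology Real

variable {E : Type*} [NormedAddCommGroup E] [InnerProductSpace ℂ E]

/-- The operator norm is at most the Hilbert–Schmidt norm. -/
lemma norm_le_norm_of_apply_hilbertBasis {ι : Type*} (b : HilbertBasis ι ℂ E) (T : E →L[ℂ] E)
    (t : lp (fun _ : ι => E) 2) (ht : ∀ i, t i = T (b i)) : ‖T‖ ≤ ‖t‖ := by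
  refine T.opNorm_le_bound (norm_nonneg t) fun x => ?_
  have hsum : HasSum (fun i => b.repr x i • T (b i)) (T x) := by
    simpa using T.hasSum (b.hasSum_repr x)
  refine le_of_tendsto hsum.norm (Eventually.of_forall fun s => ?_)
  have h2 : 0 < (2 : ℝ≥0∞).toReal := by norm_num
  have h3 : ∑ i ∈ s, ‖t i‖ ^ 2 ≤ ‖t‖ ^ 2 := by
    simpa using lp.sum_rpow_le_norm_rpow h2 t s
  have h4 : ∑ i ∈ s, ‖b.repr x i‖ ^ 2 ≤ ‖x‖ ^ 2 := by
    simpa using lp.sum_rpow_le_norm_rpow h2 (b.repr x) s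
  calc ‖∑ i ∈ s, b.repr x i • T (b i)‖ ≤ ∑ i ∈ s, ‖t i‖ * ‖b.repr x i‖ := by
        refine norm_sum_le_of_le _ fun i _ => ?_
        rw [norm_smul, ht, mul_comm]
    _ ≤ ‖t‖ * ‖x‖ := by
        refine abs_le_of_sq_le_sq' ?_ (by positivity) |>.2
        refine (Finset.sum_mul_sq_le_sq_mul_sq _ _ _).trans ?_
        rw [mul_pow]
        gcongr

variable [CompleteSpace E]

/-- An operator `T` of finite rank `n` has squared Hilbert–Schmidt norm at most `n ‖T‖²`. -/
lemma sum_norm_sq_apply_le_finrank_mul {ι : Type*} {v : ι → E} (hv : Orthonormal ℂ v)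
    (T : E →L[ℂ] E) [FiniteDimensional ℂ (ran T)] (s : Finset ι) :
    ∑ i ∈ s, ‖T (v i)‖ ^ 2 ≤ Module.finrank ℂ (ran T) * ‖T‖ ^ 2 := by
  let f := stdOrthonormalBasis ℂ (ran T)
  have h1 : ∀ x, ‖T x‖ ^ 2 = ∑ j, ‖⟪x, ContinuousLinearMap.adjoint T (f j)⟫_ℂ‖ ^ 2 := by
    intro x
    have := f.sum_sq_norm_inner_right ⟨T x, LinearMap.mem_range_self (T : E →ₗ[ℂ] E) x⟩
    rw [Submodule.coe_norm] at this
    rw [← this]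
    refine Finset.sum_congr rfl fun j _ => ?_
    rw [ContinuousLinearMap.adjoint_inner_right, Submodule.coe_inner, norm_inner_symm]
  simp_rw [h1]
  rw [Finset.sum_comm]
  calc ∑ j, ∑ i ∈ s, ‖⟪v i, ContinuousLinearMap.adjoint T (f j)⟫_ℂ‖ ^ 2
      ≤ ∑ _j : Fin (Module.finrank ℂ (ran T)), ‖T‖ ^ 2 := by
        refine Finset.sum_le_sum fun j _ => (hv.sum_inner_products_le _).trans ?_
        have h2 := (ContinuousLinearMap.adjoint T).le_opNorm (f j)
        have h3 : ‖((f j : ran T) : E)‖ = 1 := by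
          rw [← Submodule.coe_norm]; exact f.orthonormal.1 j
        rw [h3, mul_one, LinearIsometryEquiv.norm_map] at h2
        gcongr
    _ = Module.finrank ℂ (ran T) * ‖T‖ ^ 2 := by simp

/-- The Taylor coefficients of an operator function inherit a bound on its Hilbert–Schmidt
norms. -/
lemma sum_norm_sq_taylorCoeff_apply_le {ι : Type*} {v : ι → E} {R : ℂ → E →L[ℂ] E}
    (hR : DifferentiableOn ℂ R unitDisk) {C : ℝ} {s : Finset ι}
    (hC : ∀ z ∈ unitDisk, ∑ i ∈ s, ‖R z (v i)‖ ^ 2 ≤ C) (n : ℕ) :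
    ∑ i ∈ s, ‖taylorCoeff R n (v i)‖ ^ 2 ≤ C := by
  have hpi := pi_pos
  have hρ : ∀ ρ ∈ Set.Ioo (0 : ℝ) 1, (∑ i ∈ s, ‖taylorCoeff R n (v i)‖ ^ 2) * ρ ^ (2 * n) ≤ C := by
    intro ρ hρ
    have hcirc : ∀ θ, circleMap 0 ρ θ ∈ unitDisk := by
      intro θ
      rw [mem_unitDisk, norm_circleMap_zero, abs_of_pos hρ.1]
      exact hρ.2
    have hone : ∀ i, 2 * π * (‖taylorCoeff R n (v i)‖ ^ 2 * ρ ^ (2 * n)) ≤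
        ∫ θ in (-π)..π, ‖R (circleMap 0 ρ θ) (v i)‖ ^ 2 := by
      intro i
      have hs : ∀ z ∈ unitDisk, HasSum (fun n => z ^ n • taylorCoeff R n (v i)) (R z (v i)) := by
        intro z hz
        simpa using (ContinuousLinearMap.apply ℂ E (v i)).hasSum (hasSum_taylorCoeff hR hz)
      have hmono : Monotone fun N => 2 * π * ∑ n ∈ Finset.range N,
          ‖taylorCoeff R n (v i)‖ ^ 2 * ρ ^ (2 * n) := by
        intro a b hab
        have := hρ.1
        dsimp only
        gcongr
      refine le_trans ?_ (hmono.ge_of_tendsto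
        (tendsto_sum_norm_sq_mul_pow hs hρ.1.le hρ.2) (n + 1))
      refine mul_le_mul_of_nonneg_left ?_ (by positivity)
      have := hρ.1
      exact Finset.single_le_sum (f := fun n => ‖taylorCoeff R n (v i)‖ ^ 2 * ρ ^ (2 * n))
        (fun _ _ => by positivity) (Finset.self_mem_range_succ n)
    have hcont : ∀ i, Continuous fun θ => ‖R (circleMap 0 ρ θ) (v i)‖ ^ 2 := by
      intro i
      have : Continuous fun θ => R (circleMap 0 ρ θ) :=
        hR.continuousOn.comp_continuous (continuous_circleMap 0 ρ) hcirc
      exact (this.clm_apply continuous_const).norm.pow 2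
    have hle : 2 * π * ((∑ i ∈ s, ‖taylorCoeff R n (v i)‖ ^ 2) * ρ ^ (2 * n)) ≤ 2 * π * C :=
      calc 2 * π * ((∑ i ∈ s, ‖taylorCoeff R n (v i)‖ ^ 2) * ρ ^ (2 * n))
          = ∑ i ∈ s, 2 * π * (‖taylorCoeff R n (v i)‖ ^ 2 * ρ ^ (2 * n)) := by
            rw [Finset.sum_mul, Finset.mul_sum]
        _ ≤ ∑ i ∈ s, ∫ θ in (-π)..π, ‖R (circleMap 0 ρ θ) (v i)‖ ^ 2 :=
            Finset.sum_le_sum fun i _ => hone i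
        _ = ∫ θ in (-π)..π, ∑ i ∈ s, ‖R (circleMap 0 ρ θ) (v i)‖ ^ 2 :=
            (intervalIntegral.integral_finsetSum
              fun i _ => (hcont i).intervalIntegrable _ _).symm
        _ ≤ ∫ _θ in (-π)..π, C :=
            intervalIntegral.integral_mono_on (by linarith)
              ((continuous_finsetSum _ fun i _ => hcont i).intervalIntegrable _ _)
              intervalIntegrable_const fun θ _ => hC _ (hcirc θ)
        _ = 2 * π * C := by
            rw [intervalIntegral.integral_const, smul_eq_mul]; ring
    exact le_of_mul_le_mul_left hle (by positivity)
  have hcont : Continuous fun ρ : ℝ =>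
      (∑ i ∈ s, ‖taylorCoeff R n (v i)‖ ^ 2) * ρ ^ (2 * n) := by fun_prop
  have hlim := (hcont.tendsto 1).mono_left (nhdsWithin_le_nhds (s := Set.Iio 1))
  simp only [one_pow, mul_one] at hlim
  refine le_of_tendsto hlim ?_
  filter_upwards [Ioo_mem_nhdsLT (zero_lt_one (α := ℝ))] with ρ h using hρ ρ h

/-- A holomorphic operator function with uniformly bounded Hilbert–Schmidt norms is holomorphic
as a function with values in the Hilbert–Schmidt operators, here encoded as the square summable
families `i ↦ R z (v i)`. -/
lemma exists_differentiableOn_lp {ι : Type*} {v : ι → E} {R : ℂ → E →L[ℂ] E}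
    (hR : DifferentiableOn ℂ R unitDisk) {C : ℝ} (hC0 : 0 ≤ C)
    (hC : ∀ z ∈ unitDisk, ∀ s : Finset ι, ∑ i ∈ s, ‖R z (v i)‖ ^ 2 ≤ C ^ 2) :
    ∃ f : ℂ → lp (fun _ : ι => E) 2, DifferentiableOn ℂ f unitDisk ∧
      (∀ z ∈ unitDisk, ‖f z‖ ≤ C) ∧ ∀ z ∈ unitDisk, ∀ i, f z i = R z (v i) := by
  have h2 : 0 < (2 : ℝ≥0∞).toReal := by norm_num
  have hcoeff : ∀ n (s : Finset ι), ∑ i ∈ s, ‖taylorCoeff R n (v i)‖ ^ (2 : ℝ≥0∞).toReal ≤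
      C ^ (2 : ℝ≥0∞).toReal := by
    intro n s
    simpa using sum_norm_sq_taylorCoeff_apply_le hR (fun z hz => hC z hz s) n
  let α : ℕ → lp (fun _ : ι => E) 2 := fun n =>
    ⟨fun i => taylorCoeff R n (v i), memℓp_gen' (hcoeff n)⟩
  have hα : ∀ n, ‖α n‖ ≤ C := fun n => lp.norm_le_of_forall_sum_le h2 hC0 (hcoeff n)
  have hbound : ∀ σ : ℝ, ∀ z : ℂ, ‖z‖ ≤ σ → ∀ n, ‖z ^ n • α n‖ ≤ σ ^ n * C := by
    intro σ z hz n
    rw [norm_smul, norm_pow]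
    have := hα n
    gcongr
    exact pow_nonneg ((norm_nonneg z).trans hz) n
  have hsumm : ∀ z ∈ unitDisk, Summable fun n => z ^ n • α n := by
    intro z hz
    exact Summable.of_norm_bounded
      ((summable_geometric_of_lt_one (norm_nonneg z) (mem_unitDisk.1 hz)).mul_right C)
      (hbound ‖z‖ z le_rfl)
  have hcoord : ∀ z ∈ unitDisk, ∀ i, (∑' n, z ^ n • α n) i = R z (v i) := by
    intro z hz i
    have h3 := (lp.evalCLM ℂ (fun _ : ι => E) 2 i).hasSum (hsumm z hz).hasSum
    have h4 := (ContinuousLinearMap.apply ℂ E (v i)).hasSum (hasSum_taylorCoeff hR hz)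
    refine h3.unique ?_
    simp only [map_smul, ContinuousLinearMap.apply_apply] at h4 ⊢
    exact h4
  refine ⟨fun z : ℂ => ∑' n, z ^ n • α n, ?_, ?_, hcoord⟩
  · intro z hz
    obtain ⟨σ, hσ1, hσ2⟩ := exists_between (mem_unitDisk.1 hz)
    have hσ0 : 0 ≤ σ := (norm_nonneg z).trans hσ1.le
    have hd : DifferentiableOn ℂ (fun z : ℂ => ∑' n, z ^ n • α n) (ball 0 σ) :=
      Complex.differentiableOn_tsum_of_summable_norm
        ((summable_geometric_of_lt_one hσ0 hσ2).mul_right C)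
        (fun n => ((differentiable_pow n).smul_const (α n)).differentiableOn) isOpen_ball
        fun n w hw => hbound σ w (mem_ball_zero_iff.1 hw).le n
    exact (hd.differentiableAt
      (isOpen_ball.mem_nhds (mem_ball_zero_iff.2 hσ1))).differentiableWithinAt
  · intro z hz
    refine lp.norm_le_of_forall_sum_le h2 hC0 fun s => ?_
    simp only [hcoord z hz]
    simpa using hC z hz s

end HilbertSchmidt

/-! ### The derivative of the orthogonal projection -/

section Projections

universe u

variable {E : Type u} [NormedAddCommGroup E] [InnerProductSpace ℂ E] {P Q : ℂ → E →L[ℂ] E}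

lemma IsBoundedAnalyticProjectionOnto.mul_eq_right (hP : IsBoundedAnalyticProjectionOnto P Q)
    {z : ℂ} (hz : z ∈ unitDisk) : P z * Q z = Q z :=
  mul_eq_right_of_ran_le (hP.idempotent z hz) (hP.range_eq z hz).ge

variable [CompleteSpace E]

lemma IsBoundedAnalyticProjectionOnto.mul_eq_left (hP : IsBoundedAnalyticProjectionOnto P Q)
    (hQ : ∀ z ∈ unitDisk, IsStarProjection (Q z)) {z : ℂ} (hz : z ∈ unitDisk) :
    Q z * P z = P z :=
  mul_eq_right_of_ran_le (hQ z hz).isIdempotentElem (hP.range_eq z hz).le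

lemma IsBoundedAnalyticProjectionOnto.contDiffOn (hP : IsBoundedAnalyticProjectionOnto P Q)
    (hQ : ∀ z ∈ unitDisk, IsStarProjection (Q z)) : ContDiffOn ℝ 2 Q unitDisk := by
  have hPc : ContDiffOn ℝ 2 P unitDisk := hP.analytic.contDiffOn_real_unitDisk 2
  have hX : ContDiffOn ℝ 2 (fun z => P z + star (P z) - 1) unitDisk :=
    (hPc.add ((starL' ℝ (A := E →L[ℂ] E)).contDiff.comp_contDiffOn hPc)).sub contDiffOn_const
  have hinv : ContDiffOn ℝ 2 (fun z => Ring.inverse (P z + star (P z) - 1)) unitDisk := by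
    intro z hz
    obtain ⟨u, hu⟩ := isUnit_add_star_sub_one (hP.idempotent z hz)
    have h := contDiffAt_ringInverse ℝ (n := 2) u
    rw [hu] at h
    exact h.comp_contDiffWithinAt z (hX z hz)
  exact (hPc.mul hinv).congr fun z hz => eq_mul_inverse_add_star_sub_one (hP.idempotent z hz)
    (hQ z hz) (hP.mul_eq_left hQ hz) (hP.mul_eq_right hz)

/-- Differentiating `Q P = P`, `P Q = Q` and `Q* = Q`, and using `∂̄P = 0`, gives `∂̄Q = Q ∂̄Q`
and `∂̄Q Q = 0`, whose adjoints are `∂Q = ∂Q Q` and `Q ∂Q = 0`; then `∂Q P + Q P' = P'` yields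
`∂Q = (1 - Q) P' Q`. -/
lemma IsBoundedAnalyticProjectionOnto.dz_identities (hP : IsBoundedAnalyticProjectionOnto P Q)
    (hQ : ∀ z ∈ unitDisk, IsStarProjection (Q z)) {z : ℂ} (hz : z ∈ unitDisk) :
    Q z * dz Q z = 0 ∧ dz Q z = (1 - Q z) * deriv P z * Q z := by
  have hPd : HasFDerivAt P (ContinuousLinearMap.restrictScalars ℝ
      (ContinuousLinearMap.toSpanSingleton ℂ (deriv P z))) z :=
    ((hP.analytic.differentiableAt (unitDisk_mem_nhds hz)).hasDerivAt.hasFDerivAt).restrictScalars ℝ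
  have hQd : HasFDerivAt Q (fderiv ℝ Q z) z :=
    (((hP.contDiffOn hQ).contDiffAt (unitDisk_mem_nhds hz)).differentiableAt
      (by norm_num)).hasFDerivAt
  have hQP : ∀ v : ℂ, Q z * (v • deriv P z) + fderiv ℝ Q z v * P z = v • deriv P z := by
    intro v
    have h := (hQd.mul' hPd).unique (hPd.congr_of_eventuallyEq (by
      filter_upwards [unitDisk_mem_nhds hz] with w hw using hP.mul_eq_left hQ hw))
    simpa using congrArg (fun L : ℂ →L[ℝ] (E →L[ℂ] E) => L v) h
  have hPQ : ∀ v : ℂ, P z * fderiv ℝ Q z v + (v • deriv P z) * Q z = fderiv ℝ Q z v := by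
    intro v
    have h := (hPd.mul' hQd).unique (hQd.congr_of_eventuallyEq (by
      filter_upwards [unitDisk_mem_nhds hz] with w hw using hP.mul_eq_right hw))
    simpa using congrArg (fun L : ℂ →L[ℝ] (E →L[ℂ] E) => L v) h
  have hstar : ∀ v : ℂ, star (fderiv ℝ Q z v) = fderiv ℝ Q z v := by
    intro v
    have h := ((starL' ℝ (A := E →L[ℂ] E)).hasFDerivAt.comp z hQd).unique
      (hQd.congr_of_eventuallyEq (by
        filter_upwards [unitDisk_mem_nhds hz] with w hw using (hQ w hw).isSelfAdjoint))
    simpa using congrArg (fun L : ℂ →L[ℝ] (E →L[ℂ] E) => L v) h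
  have hQQ : Q z * Q z = Q z := (hQ z hz).isIdempotentElem
  have hQs : star (Q z) = Q z := (hQ z hz).isSelfAdjoint
  have hqp := hP.mul_eq_left hQ hz
  have hpq := hP.mul_eq_right hz
  set A := fderiv ℝ Q z 1 with hA
  set B := fderiv ℝ Q z Complex.I with hB
  set p := deriv P z
  have hQP1 := hQP 1
  have hQPI := hQP Complex.I
  have hPQ1 := hPQ 1
  have hPQI := hPQ Complex.I
  rw [one_smul] at hQP1 hPQ1
  rw [mul_smul_comm] at hQPI
  rw [smul_mul_assoc] at hPQI
  have hI : ∀ x : E →L[ℂ] E, Complex.I • Complex.I • x = -x := by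
    intro x
    rw [smul_smul, Complex.I_mul_I, neg_one_smul]
  -- `D = 2 ∂̄Q`
  set D := A + Complex.I • B with hD
  have hDstar : star D = A - Complex.I • B := by
    rw [hD, star_add, star_smul, hstar, hstar, RCLike.star_def, Complex.conj_I, neg_smul,
      sub_eq_add_neg]
  have hDP : D * P z = 0 := by
    have h := congrArg₂ (· + ·) hQP1 (congrArg (Complex.I • ·) hQPI)
    simp only [smul_add, hI] at h
    rw [hD, add_mul, smul_mul_assoc]
    rw [add_neg_cancel] at h
    rw [← h]
    abel
  have hPD : P z * D = D := by
    have h := congrArg₂ (· + ·) hPQ1 (congrArg (Complex.I • ·) hPQI)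
    simp only [smul_add, hI] at h
    rw [hD, mul_add, mul_smul_comm]
    rw [← h]
    abel
  have hDQ : D * Q z = 0 := by rw [← hpq, ← mul_assoc, hDP, zero_mul]
  have hQD : Q z * D = D := by rw [← hPD, ← mul_assoc, hqp]
  have hdz : dz Q z = (1 / 2 : ℂ) • star D := by rw [dz, hDstar]
  have h0 : Q z * star D = 0 := by
    have := congrArg star hDQ
    rwa [star_mul, hQs, star_zero] at this
  have h1 : star D * Q z = star D := by
    have := congrArg star hQD
    rwa [star_mul, hQs] at this
  have h2 : star D * P z + (2 : ℂ) • (Q z * p) = (2 : ℂ) • p := by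
    have h := congrArg₂ (· - ·) hQP1 (congrArg (Complex.I • ·) hQPI)
    simp only [smul_add, hI] at h
    rw [hDstar, sub_mul, smul_mul_assoc, two_smul, two_smul]
    rw [sub_neg_eq_add] at h
    rw [← h]
    abel
  refine ⟨by rw [hdz, mul_smul_comm, h0, smul_zero], ?_⟩
  have h3 : star D * P z = (2 : ℂ) • ((1 - Q z) * p) := by
    rw [sub_mul, one_mul, smul_sub, ← h2, add_sub_cancel_right]
  have h4 : star D = (2 : ℂ) • ((1 - Q z) * p) * Q z := by
    rw [← h3, mul_assoc, hpq, h1]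
  rw [hdz, h4, smul_mul_assoc, smul_smul]
  norm_num

lemma IsBoundedAnalyticProjectionOnto.norm_dz_le (hP : IsBoundedAnalyticProjectionOnto P Q)
    (hQ : ∀ z ∈ unitDisk, IsStarProjection (Q z)) {z : ℂ} (hz : z ∈ unitDisk) :
    ‖dz Q z‖ ≤ ‖deriv P z‖ := by
  rw [(hP.dz_identities hQ hz).2]
  have h1 : ‖1 - Q z‖ ≤ 1 := (hQ z hz).one_sub.norm_le
  have h2 : ‖Q z‖ ≤ 1 := (hQ z hz).norm_le
  calc ‖(1 - Q z) * deriv P z * Q z‖ ≤ ‖1 - Q z‖ * ‖deriv P z‖ * ‖Q z‖ :=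
        (norm_mul_le _ _).trans (by gcongr; exact norm_mul_le _ _)
    _ ≤ 1 * ‖deriv P z‖ * 1 := by gcongr
    _ = ‖deriv P z‖ := by ring

/-- A bounded holomorphic family of idempotents of finite rank is a bounded holomorphic family of
Hilbert–Schmidt operators, since its rank is constant. -/
lemma exists_differentiableOn_lp_of_finiteDimensional {R : ℂ → E →L[ℂ] E}
    (hR : DifferentiableOn ℂ R unitDisk) {M : ℝ} (hM : ∀ z ∈ unitDisk, ‖R z‖ ≤ M)
    (hidem : ∀ z ∈ unitDisk, R z * R z = R z) (h0 : FiniteDimensional ℂ (ran (R 0))) :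
    ∃ (ι : Type u) (f : ℂ → lp (fun _ : ι => E) 2) (K : ℝ), DifferentiableOn ℂ f unitDisk ∧
      (∀ z ∈ unitDisk, ‖f z‖ ≤ K) ∧ ∀ z ∈ unitDisk, ‖deriv R z‖ ≤ ‖deriv f z‖ := by
  obtain ⟨w, b, -⟩ := exists_hilbertBasis ℂ E
  have hzero : (0 : ℂ) ∈ unitDisk := by simp [mem_unitDisk]
  set n := Module.finrank ℂ (ran (R 0)) with hn
  have hC : ∀ z ∈ unitDisk, ∀ s : Finset w, ∑ i ∈ s, ‖R z (b i)‖ ^ 2 ≤ (√n * M) ^ 2 := by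
    intro z hz s
    have := finiteDimensional_ran_of_continuousOn hR.continuousOn hidem hzero hz h0
    refine (sum_norm_sq_apply_le_finrank_mul b.orthonormal (R z) s).trans ?_
    have hrank : Module.finrank ℂ (ran (R z)) = n :=
      congrArg Cardinal.toNat (rank_ran_eq_of_continuousOn hR.continuousOn hidem hz hzero)
    rw [hrank, mul_pow, Real.sq_sqrt n.cast_nonneg]
    have := hM z hz
    gcongr
  have hM0 : 0 ≤ M := (norm_nonneg _).trans (hM 0 hzero)
  obtain ⟨f, hf, hfK, hfR⟩ := exists_differentiableOn_lp hR (by positivity) hC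
  refine ⟨w, f, _, hf, hfK, fun z hz => norm_le_norm_of_apply_hilbertBasis b _ _ fun i => ?_⟩
  have h1 : HasDerivAt (fun z => f z i) (deriv f z i) z :=
    (lp.evalCLM ℂ (fun _ : w => E) 2 i).hasFDerivAt.comp_hasDerivAt z
      (hf.differentiableAt (unitDisk_mem_nhds hz)).hasDerivAt
  have h2 : HasDerivAt (fun z => R z (b i)) (deriv R z (b i)) z :=
    (ContinuousLinearMap.apply ℂ E (b i)).hasFDerivAt.comp_hasDerivAt z
      (hR.differentiableAt (unitDisk_mem_nhds hz)).hasDerivAt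
  refine h1.unique (h2.congr_of_eventuallyEq ?_)
  filter_upwards [unitDisk_mem_nhds hz] with y hy using hfR y hy i

/-- In finite dimension or codimension, `‖∂Q‖` is dominated by the norm of the derivative of a
bounded holomorphic Hilbert space valued function: the Hilbert–Schmidt operator `P` or `1 - P`. -/
lemma IsBoundedAnalyticProjectionOnto.exists_norm_dz_le
    (hP : IsBoundedAnalyticProjectionOnto P Q)
    (hQ : ∀ z ∈ unitDisk, IsStarProjection (Q z))
    (hdim : FiniteDimensional ℂ (ran (Q 0)) ∨ FiniteDimensional ℂ (E ⧸ ran (Q 0))) :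
    ∃ (ι : Type u) (f : ℂ → lp (fun _ : ι => E) 2) (K : ℝ), DifferentiableOn ℂ f unitDisk ∧
      (∀ z ∈ unitDisk, ‖f z‖ ≤ K) ∧ ∀ z ∈ unitDisk, ‖dz Q z‖ ≤ ‖deriv f z‖ := by
  obtain ⟨M, hM⟩ := hP.bounded
  have hzero : (0 : ℂ) ∈ unitDisk := by simp [mem_unitDisk]
  rw [← hP.range_eq 0 hzero] at hdim
  rcases hdim with h | h
  · obtain ⟨ι, f, K, hf, hK, hd⟩ :=
      exists_differentiableOn_lp_of_finiteDimensional hP.analytic hM hP.idempotent h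
    exact ⟨ι, f, K, hf, hK, fun z hz => (hP.norm_dz_le hQ hz).trans (hd z hz)⟩
  · obtain ⟨ι, f, K, hf, hK, hd⟩ :=
      exists_differentiableOn_lp_of_finiteDimensional (R := fun z => 1 - P z)
        (hP.analytic.const_sub 1) (M := ‖(1 : E →L[ℂ] E)‖ + M)
        (fun z hz => (norm_sub_le _ _).trans (by gcongr; exact hM z hz))
        (fun z hz => IsIdempotentElem.one_sub (hP.idempotent z hz))
        (finiteDimensional_ran_one_sub (hP.idempotent 0 hzero) h)
    refine ⟨ι, f, K, hf, hK, fun z hz => (hP.norm_dz_le hQ hz).trans ?_⟩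
    have := hd z hz
    rwa [deriv_const_sub, norm_neg] at this

end Projections

theorem proposition0p5 {E : Type*} [NormedAddCommGroup E] [InnerProductSpace ℂ E] [CompleteSpace E]
    (Q : ℂ → E →L[ℂ] E)
    (hQ : ∀ z ∈ unitDisk, IsStarProjection (Q z))
    (hP : ∃ P : ℂ → E →L[ℂ] E, IsBoundedAnalyticProjectionOnto P Q)
    (hdim : ∀ z ∈ unitDisk,
      FiniteDimensional ℂ (ran (Q z)) ∨ FiniteDimensional ℂ (E ⧸ ran (Q z))) :
    (ContDiffOn ℝ 2 Q unitDisk ∧ ∀ z ∈ unitDisk, Q z * dz Q z = 0) ∧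
      DzGrowth Q ∧
      IsCarlesonMeasure (dzMeasure Q) ∧
      HasBoundedSubharmonicMajorant Q := by
  obtain ⟨P, hP⟩ := hP
  obtain ⟨M, hM⟩ := hP.bounded
  have hzero : (0 : ℂ) ∈ unitDisk := by simp [mem_unitDisk]
  obtain ⟨ι, f, K, hf, hK, hd⟩ := hP.exists_norm_dz_le hQ (hdim 0 hzero)
  have hK0 : 0 ≤ K := (norm_nonneg _).trans (hK 0 hzero)
  refine ⟨⟨hP.contDiffOn hQ, fun z hz => (hP.dz_identities hQ hz).1⟩, ⟨2 * M, fun z hz => ?_⟩,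
    ⟨?_, ⟨16 * Real.pi * K ^ 2, by positivity⟩, fun ξ hξ r hr => ?_⟩,
    fun z => ‖f z‖ ^ 2, contDiffOn_norm_sq hf, isSubharmonicOn_norm_sq hf,
    ⟨K ^ 2, fun z hz => ⟨by positivity, pow_le_pow_left₀ (norm_nonneg _) (hK z hz) 2⟩⟩,
    fun z hz => ?_⟩
  · exact (hP.norm_dz_le hQ hz).trans (norm_deriv_le_of_bounded hP.analytic hM hz)
  · rw [dzMeasure, withDensity_apply _ isOpen_unitDisk.measurableSet.compl,
      Measure.restrict_restrict isOpen_unitDisk.measurableSet.compl]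
    simp
  · have hmeas : MeasurableSet (ball ξ r ∩ unitDisk) :=
      measurableSet_ball.inter isOpen_unitDisk.measurableSet
    rw [dzMeasure, withDensity_apply _ hmeas, Measure.restrict_restrict hmeas, Set.inter_assoc,
      Set.inter_self]
    refine le_trans (setLIntegral_mono' hmeas fun z hz => ENNReal.ofReal_le_ofReal ?_)
      (lintegral_ball_norm_sq_deriv_le hf hK hξ hr)
    have h1 : 0 ≤ 1 - ‖z‖ := by linarith [mem_unitDisk.1 hz.2]
    have := hd z hz.2
    gcongr
  · rw [normalizedLaplacian_norm_sq hf hz]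
    have := hd z hz
    gcongr
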